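/- Let $R$ be a commutative ring. A cochain complex $A^\bullet$ of $R$-modules is *pure acyclic* if $N\otimes_R A^\bullet$ is acyclic for every $R$-module $N$; a morphism of complexes is a *pure quasi-isomorphism* if its mapping cone is pure acyclic. An $R$-module $P$ is *pure projective* if $\mathrm{Hom}_R(P,-)$ carries pure acyclic complexes to pure acyclic complexes. A complex $P^\bullet$ is *$K$-pure projective* if the internal Hom functor $\mathrm{Hom}_R^\bullet(P^\bullet,-)$ carries pure acyclic complexes to pure acyclic complexes. A *pure projective resolution* of $M^\bullet$ is a pure quasi-isomorphism $P^\bullet\to M^\bullet$ where $P^\bullet$ is a $K$-pure projective complex all of whose terms are pure projective modules. A direct system $P_0^\bullet\to P_1^\bullet\to\cdots$ of complexes is a *special direct system of $K$-pure projective complexes* if $P_0^\bullet$ is $K$-pure projective and, for every $n\ge 0$, the map $P_n^\bullet\to P_{n+1}^\bullet$ is injective, its cokernel $C_{n+1}^\bullet$ is $K$-pure projective, and $0\to P_n^\bullet\to P_{n+1}^\bullet\to C_{n+1}^\bullet\to 0$ is split in each degree. For $n\in\mathbb Z$ let $\tau_{\le n}M^\bullet\subseteq M^\bullet$ be the subcomplex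 equal to $M^i$ in degrees $i<n$, to $\ker(d^n)$ in degree $n$, and to $0$ in degrees $i>n$. **Theorem.** Let $M^\bullet$ be any cochain complex of $R$-modules, possibly unbounded. Then $M^\bullet$ has a pure projective resolution. More precisely, there are a special direct system $\{P_n^\bullet\}_{n\ge 0}$ of $K$-pure projective complexes and a morphism of direct systems $\{f_n:P_n^\bullet\to\tau_{\le n}M^\bullet\}_{n\ge 0}$ such that each $P_n^\bullet$ is bounded above and each $f_n$ is a pure projective resolution of $\tau_{\le n}M^\bullet$, and such that the morphism $$\varinjlim_{n\ge 0}P_n^\bullet\longrightarrow \varinjlim_{n\ge 0}\tau_{\le n}M^\bullet=M^\bullet$$ induced by the $f_n$ is a pure projective resolution of $M^\bullet$. -/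

import Mathlib

open CategoryTheory CategoryTheory.Limits Opposite

universe u

noncomputable section

namespace PureResolution

variable {R : Type u} [CommRing R]

/-- A complex `A` is pure acyclic if `N ⊗ A` is acyclic for every module `N`. -/
def IsPureAcyclic (A : CochainComplex (ModuleCat.{u} R) ℤ) : Prop :=
  ∀ N : ModuleCat.{u} R,
    (((MonoidalCategory.tensorLeft N).mapHomologicalComplex (ComplexShape.up ℤ)).obj A).Acyclic

/-- A morphism of complexes is a pure quasi-isomorphism if its mapping cone is pure acyclic. -/
def IsPureQuasiIso {K L : CochainComplex (ModuleCat.{u} R) ℤ} (f : K ⟶ L) : Prop :=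
  IsPureAcyclic (CochainComplex.mappingCone f)

/-- The complex `Hom_R(P, A)` of `R`-modules, for a module `P` and a complex `A`. -/
def moduleHomComplex (P : ModuleCat.{u} R) (A : CochainComplex (ModuleCat.{u} R) ℤ) :
    CochainComplex (ModuleCat.{u} R) ℤ :=
  (((linearCoyoneda R (ModuleCat.{u} R)).obj (op P)).mapHomologicalComplex
    (ComplexShape.up ℤ)).obj A

/-- A module `P` is pure projective if `Hom_R(P, -)` sends pure acyclic complexes to pure acyclic
complexes. -/
def IsPureProjective (P : ModuleCat.{u} R) : Prop :=
  ∀ A : CochainComplex (ModuleCat.{u} R) ℤ, IsPureAcyclic A →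
    IsPureAcyclic (moduleHomComplex P A)

/-- The internal Hom complex of `R`-modules: in degree `i` it is the product over `j` of the
modules `Hom_R (K^j, L^(i+j))`, with differential `f ↦ d ∘ f - (-1)^i f ∘ d`. It is Mathlib's
`CochainComplex.HomComplex` with its `R`-linear structure. -/
def homComplex (K L : CochainComplex (ModuleCat.{u} R) ℤ) :
    CochainComplex (ModuleCat.{u} R) ℤ where
  X i := ModuleCat.of R (CochainComplex.HomComplex.Cochain K L i)
  d i j := ModuleCat.ofHom (CochainComplex.HomComplex.δ_hom R K L i j)
  shape i j hij := by
    ext z : 2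
    exact CochainComplex.HomComplex.δ_shape i j hij z
  d_comp_d' i j k _ _ := by
    ext z : 2
    exact CochainComplex.HomComplex.δ_δ i j k z

/-- A complex `P` is K-pure projective if the internal Hom functor out of `P` sends pure acyclic
complexes to pure acyclic complexes. -/
def IsKPureProjective (P : CochainComplex (ModuleCat.{u} R) ℤ) : Prop :=
  ∀ A : CochainComplex (ModuleCat.{u} R) ℤ, IsPureAcyclic A → IsPureAcyclic (homComplex P A)

/-- `f : P ⟶ M` is a pure projective resolution of `M`. -/
structure IsPureProjectiveResolution {P M : CochainComplex (ModuleCat.{u} R) ℤ}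
    (f : P ⟶ M) : Prop where
  pureProjective : ∀ i : ℤ, IsPureProjective (P.X i)
  pureQuasiIso : IsPureQuasiIso f
  kPureProjective : IsKPureProjective P

/-- A complex is bounded above if its terms vanish in all sufficiently large degrees. -/
def IsBoundedAbove (K : CochainComplex (ModuleCat.{u} R) ℤ) : Prop :=
  ∃ n : ℤ, ∀ i : ℤ, n < i → IsZero (K.X i)

/-- The sequence `K ⟶ L ⟶ coker f` attached to a morphism of complexes `f`. -/
def cokernelSequence {K L : CochainComplex (ModuleCat.{u} R) ℤ} (f : K ⟶ L) :
    ShortComplex (CochainComplex (ModuleCat.{u} R) ℤ) :=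
  ShortComplex.mk f (cokernel.π f) (cokernel.condition f)

/-- A direct system `P₀ ⟶ P₁ ⟶ ⋯` of complexes is `T`-special if all transition morphisms are
injective, their cokernels belong to `T`, and the sequences `0 ⟶ Pₙ ⟶ Pₙ₊₁ ⟶ Cₙ₊₁ ⟶ 0` split in
each degree. The system is understood to be extended by `0` to negative indices, so that the
first cokernel is `P₀` itself. -/
structure IsSpecialDirectSystem (T : CochainComplex (ModuleCat.{u} R) ℤ → Prop)
    (P : ℕ ⥤ CochainComplex (ModuleCat.{u} R) ℤ) : Prop where
  zero_mem : T (P.obj 0)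
  mono : ∀ n : ℕ, Mono (P.map (homOfLE n.le_succ))
  cokernel_mem : ∀ n : ℕ, T (cokernel (P.map (homOfLE n.le_succ)))
  semisplit : ∀ (n : ℕ) (i : ℤ), Nonempty
    ((cokernelSequence (P.map (homOfLE n.le_succ))).map
      (HomologicalComplex.eval (ModuleCat.{u} R) (ComplexShape.up ℤ) i)).Splitting

/-- The canonical morphism `τ_{≤ m} M ⟶ τ_{≤ n} M` for `m ≤ n`; it is the unique morphism
compatible with the inclusions into `M`. -/
def truncLETransition (M : CochainComplex (ModuleCat.{u} R) ℤ) (m n : ℤ) (h : m ≤ n) :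
    M.truncLE m ⟶ M.truncLE n :=
  haveI : (M.truncLE m).IsStrictlyLE n := (M.truncLE m).isStrictlyLE_of_le m n h
  inv ((M.truncLE m).ιTruncLE n) ≫ CochainComplex.truncLEMap (M.ιTruncLE m) n

lemma truncLETransition_ι (M : CochainComplex (ModuleCat.{u} R) ℤ) (m n : ℤ) (h : m ≤ n) :
    truncLETransition M m n h ≫ M.ιTruncLE n = M.ιTruncLE m := by
  have : (M.truncLE m).IsStrictlyLE n := (M.truncLE m).isStrictlyLE_of_le m n h
  simp [truncLETransition]

lemma mono_ιTruncLE (M : CochainComplex (ModuleCat.{u} R) ℤ) (n : ℤ) : Mono (M.ιTruncLE n) := by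
  dsimp [CochainComplex.ιTruncLE]
  infer_instance

/-- The direct system of truncations `τ_{≤ 0} M ⟶ τ_{≤ 1} M ⟶ ⋯`. -/
def truncLESystem (M : CochainComplex (ModuleCat.{u} R) ℤ) :
    ℕ ⥤ CochainComplex (ModuleCat.{u} R) ℤ where
  obj n := M.truncLE (n : ℤ)
  map {m n} f := truncLETransition M m n (by exact_mod_cast leOfHom f)
  map_id n := by
    have := mono_ιTruncLE M n
    rw [← cancel_mono (M.ιTruncLE n), truncLETransition_ι, Category.id_comp]
  map_comp {m n k} f g := by
    have := mono_ιTruncLE M k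
    rw [← cancel_mono (M.ιTruncLE k), Category.assoc, truncLETransition_ι, truncLETransition_ι,
      truncLETransition_ι]

/-- The cocone on the system of truncations given by the inclusions `τ_{≤ n} M ⟶ M`. -/
def truncLECocone (M : CochainComplex (ModuleCat.{u} R) ℤ) : Cocone (truncLESystem M) where
  pt := M
  ι :=
    { app := fun n => M.ιTruncLE (n : ℤ)
      naturality := fun m n f => by
        simpa [truncLESystem] using
          truncLETransition_ι M m n (by exact_mod_cast leOfHom f) }

end PureResolution

end

noncomputable section

namespace PureResolution

variable {R : Type u} [CommRing R]

open TensorProduct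

/-! Pure acyclicity can be tested by finitely presented modules: `N ⊗ A` is acyclic for all `N` iff
`Hom(F, A)` is acyclic for all finitely presented `F` (`isPureAcyclic_iff_isFPAcyclic`). The bridge
is the equational criterion for the vanishing of a tensor. Pure projectivity of modules and
complexes then follows from plain lifting properties against such `A`, because `Hom(F, A)` is again
of this kind and `Hom(F, Hom(P, A)) = Hom(P, Hom(F, A))`. The lifting properties are stable under
degreewise split extensions and under colimits of degreewise split sequences.

Resolutions come from a small object argument (`exists_factorization`). Given `g : P ⟶ N`, every
cocycle of the cone of `g` parametrized by a finitely presented module is killed by attaching that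
module as a cell. After countably many rounds nothing is left to kill, since such modules see only a
finite stage of the colimit. Factoring `Pₙ ⟶ τ_{≤ n} M ⟶ τ_{≤ n+1} M` in this way yields `Pₙ₊₁`, and
the same finiteness argument shows that the map on colimits is a pure quasi-isomorphism. -/

/-! ### Pure acyclicity: tensor products, finitely presented modules, linear systems -/

lemma acyclic_iff_forall_exists (K : CochainComplex (ModuleCat.{u} R) ℤ) :
    K.Acyclic ↔ ∀ i j k : ℤ, i + 1 = j → j + 1 = k → ∀ x : K.X j, K.d j k x = 0 →
      ∃ y : K.X i, K.d i j y = x := by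
  constructor
  · intro h i j k hij hjk
    have := h j
    rw [K.exactAt_iff' i j k (by simp [← hij]) (by simp [← hjk]),
      ShortComplex.moduleCat_exact_iff] at this
    exact this
  · intro h j
    rw [K.exactAt_iff' (j - 1) j (j + 1) (by simp) (by simp), ShortComplex.moduleCat_exact_iff]
    exact h (j - 1) j (j + 1) (by lia) rfl

lemma isPureAcyclic_iff (A : CochainComplex (ModuleCat.{u} R) ℤ) :
    IsPureAcyclic A ↔ ∀ (N : ModuleCat.{u} R) (i j k : ℤ), i + 1 = j → j + 1 = k →
      ∀ x : N ⊗[R] A.X j, (A.d j k).hom.lTensor N x = 0 →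
        ∃ y : N ⊗[R] A.X i, (A.d i j).hom.lTensor N y = x :=
  forall_congr' fun _ => acyclic_iff_forall_exists _

/-- A complex is acyclic with respect to finitely presented modules if every cocycle with values
in it and parametrized by a finitely presented module is a coboundary. -/
def IsFPAcyclic (A : CochainComplex (ModuleCat.{u} R) ℤ) : Prop :=
  ∀ (F : ModuleCat.{u} R) [Module.FinitePresentation R F] (i j k : ℤ), i + 1 = j → j + 1 = k →
    ∀ x : F ⟶ A.X j, x ≫ A.d j k = 0 → ∃ y : F ⟶ A.X i, y ≫ A.d i j = x

/-- Every solution in cocycles of a finite system of linear equations is the boundary of a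
solution. -/
def IsMatrixAcyclic (A : CochainComplex (ModuleCat.{u} R) ℤ) : Prop :=
  ∀ (m n : ℕ) (r : Fin m → Fin n → R) (i j k : ℤ), i + 1 = j → j + 1 = k →
    ∀ x : Fin n → A.X j, (∀ l, A.d j k (x l) = 0) → (∀ a, ∑ l, r a l • x l = 0) →
      ∃ y : Fin n → A.X i, (∀ l, A.d i j (y l) = x l) ∧ ∀ a, ∑ l, r a l • y l = 0

section

variable {M N : Type*} [AddCommGroup M] [Module R M] [AddCommGroup N] [Module R N]

lemma exists_eq_sum_tmul_of_span_eq_top {ι : Type*} [Fintype ι] {m : ι → M}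
    (hm : Submodule.span R (Set.range m) = ⊤) (x : M ⊗[R] N) :
    ∃ n : ι → N, x = ∑ i, m i ⊗ₜ n i := by
  induction x with
  | zero => exact ⟨0, by simp⟩
  | tmul a b =>
    obtain ⟨c, rfl⟩ := (Submodule.mem_span_range_iff_exists_fun R).1
      (show a ∈ Submodule.span R (Set.range m) by simp [hm])
    exact ⟨fun i => c i • b, by simp [TensorProduct.sum_tmul, TensorProduct.smul_tmul]⟩
  | add a b ha hb =>
    obtain ⟨p, rfl⟩ := ha
    obtain ⟨q, rfl⟩ := hb
    exact ⟨p + q, by simp [TensorProduct.tmul_add, Finset.sum_add_distrib]⟩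

lemma sum_smul_apply_single {n : ℕ} (f : (Fin n → R) →ₗ[R] M) (c : Fin n → R) :
    ∑ l, c l • f (Pi.single l 1) = f c := by
  simp only [← map_smul, ← map_sum]
  congr 1
  ext l
  simp [Pi.single_apply]

/-- The linear map out of `M` determined by the images of a finite system of generators. -/
lemma exists_linearMap_of_exact {m n : ℕ} {f : (Fin n → R) →ₗ[R] M}
    {g : (Fin m → R) →ₗ[R] (Fin n → R)} (hf : Function.Surjective f) (hfg : Function.Exact g f)
    (y : Fin n → N) (hy : ∀ a, ∑ l, g (Pi.single a 1) l • y l = 0) :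
    ∃ h : M →ₗ[R] N, ∀ l, h (f (Pi.single l 1)) = y l := by
  let φ : (Fin n → R) →ₗ[R] N := Fintype.linearCombination R y
  have hφg : φ ∘ₗ g = 0 := by
    refine LinearMap.pi_ext' fun a => LinearMap.ext_ring ?_
    simpa [φ, Fintype.linearCombination_apply] using hy a
  have hker : LinearMap.ker f ≤ LinearMap.ker φ := by
    intro x hx
    obtain ⟨t, rfl⟩ := (hfg x).1 hx
    exact LinearMap.congr_fun hφg t
  refine ⟨(LinearMap.ker f).liftQ φ hker ∘ₗ (f.quotKerEquivOfSurjective hf).symm.toLinearMap,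
    fun l => ?_⟩
  have : (f.quotKerEquivOfSurjective hf).symm (f (Pi.single l 1)) =
      Submodule.Quotient.mk (Pi.single l 1) := by
    rw [LinearEquiv.symm_apply_eq]; rfl
  simp [this, φ, Fintype.linearCombination_apply, Pi.single_apply]

end

/-- Arbitrary preimages of the `x l` violate the relations only by boundaries `d (w a)`. Acyclicity
after tensoring with the module presented by the transposed matrix shows that this defect can be
corrected. -/
lemma IsPureAcyclic.isMatrixAcyclic {A : CochainComplex (ModuleCat.{u} R) ℤ}
    (hA : IsPureAcyclic A) : IsMatrixAcyclic A := by
  rw [isPureAcyclic_iff] at hA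
  have hA' : ∀ i j k : ℤ, i + 1 = j → j + 1 = k → ∀ x : A.X j, A.d j k x = 0 →
      ∃ y : A.X i, A.d i j y = x := by
    intro i j k hij hjk x hx
    obtain ⟨y, hy⟩ := hA (ModuleCat.of R R) i j k hij hjk ((1 : R) ⊗ₜ x) (by
      rw [LinearMap.lTensor_tmul]
      exact (congrArg _ hx).trans (TensorProduct.tmul_zero _ _))
    refine ⟨TensorProduct.lid R _ y, ?_⟩
    have h := congrArg (TensorProduct.lid R _) hy
    rw [TensorProduct.lid_tmul, one_smul] at h
    rw [← h]
    clear hy h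
    induction y with
    | zero => simp
    | tmul a b => simp
    | add a b ha hb => simp only [map_add, ha, hb]
  intro m n r i j k hij hjk x hx hrx
  choose y hy using fun l => hA' i j k hij hjk (x l) (hx l)
  obtain ⟨i', hi'⟩ : ∃ i', i' + 1 = i := ⟨i - 1, by lia⟩
  obtain ⟨i'', hi''⟩ : ∃ i'', i'' + 1 = i' := ⟨i' - 1, by lia⟩
  choose w hw using fun a => hA' i' i j hi' hij (∑ l, r a l • y l) (by
    simp [hy, hrx])
  -- The columns of `r` become the relations of `N`, so that `∑ ε a ⊗ w a` is a cocycle.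
  let S : Submodule R (Fin m → R) := Submodule.span R (Set.range fun l a => r a l)
  let N : ModuleCat.{u} R := ModuleCat.of R ((Fin m → R) ⧸ S)
  let ε : Fin m → N := fun a => S.mkQ (Pi.single a 1)
  have hsum : ∀ c : Fin m → R, ∑ a, c a • ε a = S.mkQ c := sum_smul_apply_single S.mkQ
  have hε : Submodule.span R (Set.range ε) = ⊤ := by
    rw [eq_top_iff]
    rintro x -
    obtain ⟨c, rfl⟩ := S.mkQ_surjective x
    rw [← hsum]
    exact Submodule.sum_mem _ fun a _ => Submodule.smul_mem _ _ (Submodule.subset_span ⟨a, rfl⟩)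
  have hrel : ∀ l, ∑ a, r a l • ε a = 0 := by
    intro l
    rw [hsum fun a => r a l]
    exact (Submodule.Quotient.mk_eq_zero S).2 (Submodule.subset_span ⟨l, rfl⟩)
  obtain ⟨v, hv⟩ := hA N i'' i' i hi'' hi' (∑ a, ε a ⊗ₜ w a) (by
    simp only [map_sum, LinearMap.lTensor_tmul]
    simp only [hw, TensorProduct.tmul_sum, TensorProduct.tmul_smul]
    rw [Finset.sum_comm]
    simp only [← TensorProduct.tmul_smul, ← TensorProduct.smul_tmul, ← TensorProduct.sum_tmul,
      hrel, TensorProduct.zero_tmul, Finset.sum_const_zero])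
  obtain ⟨v, rfl⟩ := exists_eq_sum_tmul_of_span_eq_top hε v
  -- Equational criterion: `w a - d (v a) = ∑ q, c a q • t q`, where each column of `c` is a
  -- relation of `N`, hence a combination of columns of `r`.
  obtain ⟨p, c, t, ht, hc⟩ := TensorProduct.vanishesTrivially_of_sum_tmul_eq_zero R (m := ε)
    (n := fun a => w a - A.d i'' i' (v a)) hε (by
      simp only [TensorProduct.tmul_sub, Finset.sum_sub_distrib, ← hv, map_sum,
        LinearMap.lTensor_tmul]
      exact sub_self _)
  have hc' : ∀ q, ∃ b : Fin n → R, ∀ a, c a q = ∑ l, b l * r a l := by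
    intro q
    have : (fun a => c a q) ∈ S := by
      rw [← Submodule.Quotient.mk_eq_zero, ← Submodule.mkQ_apply, ← hsum]
      exact hc q
    obtain ⟨b, hb⟩ := (Submodule.mem_span_range_iff_exists_fun R).1 this
    exact ⟨b, fun a => by simpa using (congrFun hb a).symm⟩
  choose b hb using hc'
  refine ⟨fun l => y l - A.d i' i (∑ q, b q l • t q), fun l => ?_, fun a => ?_⟩
  · rw [map_sub, hy]
    simp [← ModuleCat.comp_apply]
  · have h₁ : ∑ l, r a l • y l = A.d i' i (∑ q, c a q • t q) := by
      rw [← ht a, map_sub, hw]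
      simp [← ModuleCat.comp_apply]
    have h₂ : ∑ l, r a l • (∑ q, b q l • t q) = ∑ q, c a q • t q := by
      simp only [hb, Finset.smul_sum, Finset.sum_smul]
      rw [Finset.sum_comm]
      simp only [smul_smul, mul_comm]
    simp only [smul_sub, Finset.sum_sub_distrib, h₁, ← map_smul, ← map_sum, h₂, sub_self]

/-- Maps out of a module presented by the matrix `r` are the solutions of the linear system with
matrix `r`; the converse below uses the same dictionary. -/
lemma IsMatrixAcyclic.isFPAcyclic {A : CochainComplex (ModuleCat.{u} R) ℤ}
    (hA : IsMatrixAcyclic A) : IsFPAcyclic A := by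
  intro F _ i j k hij hjk x hx
  obtain ⟨n, m, f, g, hf, hfg⟩ := Module.FinitePresentation.exists_fin' R F
  have hsum := sum_smul_apply_single f
  obtain ⟨y, hy, hry⟩ := hA m n (fun a l => g (Pi.single a 1) l) i j k hij hjk
    (fun l => x (f (Pi.single l 1)))
    (fun l => by rw [← ModuleCat.comp_apply, hx]; rfl)
    (fun a => by
      have h : f (g (Pi.single a 1)) = 0 := (hfg _).2 ⟨_, rfl⟩
      rw [← hsum] at h
      simpa using congrArg x h)
  obtain ⟨h, hh⟩ := exists_linearMap_of_exact hf hfg y hry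
  refine ⟨ModuleCat.ofHom h, ?_⟩
  ext z
  obtain ⟨c, rfl⟩ := hf z
  rw [← hsum c, map_sum, map_sum]
  refine Finset.sum_congr rfl fun l _ => ?_
  rw [map_smul, map_smul]
  congr 1
  exact (congrArg (A.d i j) (hh l)).trans (hy l)

lemma IsFPAcyclic.isMatrixAcyclic {A : CochainComplex (ModuleCat.{u} R) ℤ}
    (hA : IsFPAcyclic A) : IsMatrixAcyclic A := by
  intro m n r i j k hij hjk x hx hrx
  let g : (Fin m → R) →ₗ[R] (Fin n → R) := Fintype.linearCombination R r
  let f := (LinearMap.range g).mkQ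
  have hf : Function.Surjective f := Submodule.mkQ_surjective _
  have hfg : Function.Exact g f := LinearMap.exact_map_mkQ_range g
  have hg : ∀ a, g (Pi.single a 1) = r a := fun a => by
    simp [g, Fintype.linearCombination_apply, Pi.single_apply]
  have : Module.FinitePresentation R (ModuleCat.of R ((Fin n → R) ⧸ LinearMap.range g)) :=
    Module.finitePresentation_of_surjective f hf (by
      rw [Submodule.ker_mkQ]
      exact Module.Finite.iff_fg.1 inferInstance)
  obtain ⟨h, hh⟩ := exists_linearMap_of_exact hf hfg x (by simpa [hg] using hrx)
  obtain ⟨y, hy⟩ := hA (ModuleCat.of R ((Fin n → R) ⧸ LinearMap.range g)) i j k hij hjk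
    (ModuleCat.ofHom h) (by
      ext z
      simpa [← hh, f] using hx z)
  refine ⟨fun l => y (f (Pi.single l 1)), fun l => ?_, fun a => ?_⟩
  · rw [← hh, ← ModuleCat.comp_apply, hy]
    rfl
  · have : ∑ l, r a l • f (Pi.single l 1) = 0 := by
      have : f (r a) = 0 := (hfg _).2 ⟨Pi.single a 1, hg a⟩
      rw [← this, sum_smul_apply_single]
    simpa using congrArg y this

/-- A cocycle of `N ⊗ A` is already a cocycle `∑ q a ⊗ x a` over a finitely generated `Q ≤ N`. The
equational criterion gives `d (x a) = ∑ l, r a l • s l` with relations `r` among the `q a`; it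
remains to alter the `x a` by such relations until they are cocycles. -/
lemma IsMatrixAcyclic.isPureAcyclic {A : CochainComplex (ModuleCat.{u} R) ℤ}
    (hA : IsMatrixAcyclic A) : IsPureAcyclic A := by
  have hA' : ∀ i j k : ℤ, i + 1 = j → j + 1 = k → ∀ x : A.X j, A.d j k x = 0 →
      ∃ y : A.X i, A.d i j y = x := by
    intro i j k hij hjk x hx
    obtain ⟨y, hy, -⟩ := hA 0 1 (fun _ _ => 0) i j k hij hjk (fun _ => x) (fun _ => hx) (by simp)
    exact ⟨y 0, hy 0⟩
  rw [isPureAcyclic_iff]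
  intro N i j k hij hjk z hz
  obtain ⟨P, hP, t, rfl⟩ := TensorProduct.exists_of_fg z
  have hcomm : ∀ {i j : ℤ} (Q : Submodule R N) (s : Q ⊗[R] A.X i),
      (A.d i j).hom.lTensor N (LinearMap.rTensor _ Q.subtype s) =
        LinearMap.rTensor _ Q.subtype ((A.d i j).hom.lTensor Q s) := by
    intro i j Q s
    simp only [← LinearMap.comp_apply, LinearMap.lTensor_comp_rTensor,
      LinearMap.rTensor_comp_lTensor]
  rw [hcomm] at hz
  obtain ⟨Q, hPQ, hQ, h⟩ := TensorProduct.eq_zero_of_fg_of_subtype_eq_zero hP hz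
  obtain ⟨m, q, hq⟩ := Submodule.fg_iff_exists_fin_generating_family.1
    (Module.Finite.fg_top (R := R) (M := Q) (self := Module.Finite.iff_fg.2 hQ))
  obtain ⟨x, hx⟩ := exists_eq_sum_tmul_of_span_eq_top hq
    (LinearMap.rTensor _ (Submodule.inclusion hPQ) t)
  rw [← LinearMap.comp_apply, LinearMap.rTensor_comp_lTensor, ← LinearMap.lTensor_comp_rTensor,
    LinearMap.comp_apply, hx, map_sum] at h
  simp only [LinearMap.lTensor_tmul] at h
  obtain ⟨n, r, s, hs, hr⟩ := TensorProduct.vanishesTrivially_of_sum_tmul_eq_zero R hq h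
  -- The `d (s l)` solve the system because `d (d (x a)) = 0`. Replacing them by boundaries of a
  -- solution `s'` leaves `s l - s' l = d (w l)`, and `x a - ∑ l, r a l • w l` is then a cocycle.
  obtain ⟨s', hs', hrs'⟩ := hA m n r k (k + 1) (k + 1 + 1) rfl rfl
    (fun l => A.d k (k + 1) (s l)) (fun l => by simp [← ModuleCat.comp_apply])
    (fun a => by
      simp only [← map_smul, ← map_sum, ← hs]
      exact (ModuleCat.comp_apply _ _ _).symm.trans (by simp))
  choose w hw using fun l => hA' j k (k + 1) hjk rfl (s l - s' l) (by simp [hs'])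
  choose y hy using fun a => hA' i j k hij hjk (x a - ∑ l, r a l • w l) (by
    have : A.d j k (x a) = ∑ l, r a l • s l := hs a
    simp [this, hw, smul_sub, Finset.sum_sub_distrib, hrs'])
  refine ⟨LinearMap.rTensor _ Q.subtype (∑ a, q a ⊗ₜ y a), ?_⟩
  have ht : LinearMap.rTensor (A.X j) P.subtype t =
      LinearMap.rTensor _ Q.subtype (LinearMap.rTensor _ (Submodule.inclusion hPQ) t) := by
    rw [← LinearMap.comp_apply, ← LinearMap.rTensor_comp, Submodule.subtype_comp_inclusion]
  rw [hcomm, ht, hx]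
  congr 1
  simp only [map_sum, LinearMap.lTensor_tmul]
  simp only [hy, TensorProduct.tmul_sub, Finset.sum_sub_distrib]
  rw [sub_eq_self]
  simp only [TensorProduct.tmul_sum, TensorProduct.tmul_smul]
  rw [Finset.sum_comm]
  simp only [← TensorProduct.tmul_smul, ← TensorProduct.smul_tmul, ← TensorProduct.sum_tmul,
    hr, TensorProduct.zero_tmul, Finset.sum_const_zero]

lemma isPureAcyclic_iff_isFPAcyclic {A : CochainComplex (ModuleCat.{u} R) ℤ} :
    IsPureAcyclic A ↔ IsFPAcyclic A :=
  ⟨fun h => h.isMatrixAcyclic.isFPAcyclic, fun h => h.isMatrixAcyclic.isPureAcyclic⟩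

/-! ### Lifting properties imply pure projectivity -/

open CochainComplex.HomComplex

/-- A module has the lifting property if every cocycle parametrized by it, with values in a complex
that is acyclic with respect to finitely presented modules, is a coboundary. -/
def HasLifting (X : ModuleCat.{u} R) : Prop :=
  ∀ A : CochainComplex (ModuleCat.{u} R) ℤ, IsFPAcyclic A → ∀ i j k : ℤ, i + 1 = j → j + 1 = k →
    ∀ x : X ⟶ A.X j, x ≫ A.d j k = 0 → ∃ y : X ⟶ A.X i, y ≫ A.d i j = x

/-- A complex `P` has the lifting property if every cocycle of the Hom complex from `P` to a complex
that is acyclic with respect to finitely presented modules is a coboundary. -/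
def HasCochainLifting (P : CochainComplex (ModuleCat.{u} R) ℤ) : Prop :=
  ∀ A : CochainComplex (ModuleCat.{u} R) ℤ, IsFPAcyclic A → ∀ i j k : ℤ, i + 1 = j → j + 1 = k →
    ∀ z : Cochain P A j, δ j k z = 0 → ∃ w : Cochain P A i, δ i j w = z

lemma finitePresentation_tensorProduct (M N : Type u) [AddCommGroup M] [Module R M]
    [AddCommGroup N] [Module R N] [Module.FinitePresentation R M] [Module.FinitePresentation R N] :
    Module.FinitePresentation R (M ⊗[R] N) := by
  obtain ⟨n, m, f, g, hf, hfg⟩ := Module.FinitePresentation.exists_fin' R M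
  have : Module.FinitePresentation R ((Fin n → R) ⊗[R] N) :=
    Module.FinitePresentation.of_equiv
      ((TensorProduct.comm R _ _ ≪≫ₗ TensorProduct.piScalarRight R R N (Fin n)).symm)
  refine Module.finitePresentation_of_surjective (f.rTensor N)
    (LinearMap.rTensor_surjective N hf) ?_
  rw [(rTensor_exact N hfg hf).linearMap_ker_eq]
  exact Module.Finite.iff_fg.1 inferInstance

section

variable {F X Y : ModuleCat.{u} R}

/-- Exchanging the arguments of a bilinear map. -/
def flipHom (x : F ⟶ ModuleCat.of R (X ⟶ Y)) : X ⟶ ModuleCat.of R (F ⟶ Y) :=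
  ModuleCat.ofHom ((ModuleCat.homLinearEquiv (S := R)).symm.toLinearMap ∘ₗ
    ((ModuleCat.homLinearEquiv (S := R)).toLinearMap ∘ₗ x.hom).flip)

end

/-- `Hom(G, Hom(F, A)) = Hom(G ⊗ F, A)`, and `G ⊗ F` is finitely presented. -/
lemma IsFPAcyclic.moduleHomComplex {A : CochainComplex (ModuleCat.{u} R) ℤ} (hA : IsFPAcyclic A)
    (F : ModuleCat.{u} R) [Module.FinitePresentation R F] :
    IsFPAcyclic (moduleHomComplex F A) := by
  intro G _ i j k hij hjk x hx
  have := finitePresentation_tensorProduct (R := R) G F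
  obtain ⟨y, hy⟩ := hA (ModuleCat.of R (G ⊗[R] F)) i j k hij hjk
    (ModuleCat.ofHom (TensorProduct.lift
      ((ModuleCat.homLinearEquiv (S := R) (M := F) (N := A.X j)).toLinearMap ∘ₗ x.hom))) (by
      ext : 1
      refine TensorProduct.ext' fun g f => ?_
      exact congrArg (fun h : F ⟶ A.X k => h f) (ConcreteCategory.congr_hom hx g))
  refine ⟨ModuleCat.ofHom ((ModuleCat.homLinearEquiv (S := R)).symm.toLinearMap ∘ₗ
    TensorProduct.curry y.hom), ?_⟩
  ext g
  refine ModuleCat.hom_ext (LinearMap.ext fun f => ?_)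
  exact ConcreteCategory.congr_hom hy (g ⊗ₜ f)

/-- A map `F ⟶ Hom(X, A)` is a map `X ⟶ Hom(F, A)`, to which the lifting property applies. -/
lemma HasLifting.isPureProjective {X : ModuleCat.{u} R} (hX : HasLifting X) :
    IsPureProjective X := by
  intro A hA
  rw [isPureAcyclic_iff_isFPAcyclic] at hA ⊢
  intro F _ i j k hij hjk x hx
  obtain ⟨y, hy⟩ := hX _ (hA.moduleHomComplex F) i j k hij hjk
    (flipHom (F := F) (X := X) (Y := A.X j) x) (by
      ext p
      refine ModuleCat.hom_ext (LinearMap.ext fun f => ?_)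
      exact congrArg (fun h : X ⟶ A.X k => h p) (ConcreteCategory.congr_hom hx f))
  refine ⟨flipHom (F := X) (X := F) (Y := A.X i) y, ?_⟩
  ext f
  refine ModuleCat.hom_ext (LinearMap.ext fun p => ?_)
  exact congrArg (fun h : F ⟶ A.X j => h f) (ConcreteCategory.congr_hom hy p)

/-- Evaluation at an element of `F`, as a morphism from the complex `Hom_R(F, A)` to `A`. -/
def evalHom (F : ModuleCat.{u} R) (A : CochainComplex (ModuleCat.{u} R) ℤ) (f : F) :
    moduleHomComplex F A ⟶ A where
  f j := ModuleCat.ofHom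
    ((LinearMap.applyₗ f) ∘ₗ (ModuleCat.homLinearEquiv (S := R) (M := F) (N := A.X j)).toLinearMap)
  comm' _ _ _ := rfl

/-- Evaluation is a morphism of complexes, so `δ` commutes with it; identities involving `δ` can
thus be checked after evaluation, without unfolding signs. -/
lemma cochain_ext_evalHom {P A : CochainComplex (ModuleCat.{u} R) ℤ} {F : ModuleCat.{u} R} {n : ℤ}
    {z₁ z₂ : Cochain P (moduleHomComplex F A) n}
    (h : ∀ f : F, z₁.comp (Cochain.ofHom (evalHom F A f)) (add_zero n) =
      z₂.comp (Cochain.ofHom (evalHom F A f)) (add_zero n)) : z₁ = z₂ := by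
  ext p q hpq t
  refine ModuleCat.hom_ext (LinearMap.ext fun f => ?_)
  have := Cochain.congr_v (h f) p q hpq
  rw [Cochain.comp_zero_cochain_v, Cochain.comp_zero_cochain_v, Cochain.ofHom_v] at this
  exact ConcreteCategory.congr_hom this t

/-- The cochain with values in `Hom_R(F, A)` corresponding to a family of cochains with values in
`A` which depends linearly on an element of `F`. -/
def flipCochain {P A : CochainComplex (ModuleCat.{u} R) ℤ} {F : ModuleCat.{u} R} {n : ℤ}
    (x : F →ₗ[R] Cochain P A n) : Cochain P (moduleHomComplex F A) n :=
  Cochain.mk fun p q h => flipHom (F := F) (X := P.X p) (Y := A.X q) (ModuleCat.ofHom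
    { toFun := fun f => (x f).v p q h
      map_add' := fun _ _ => by rw [map_add]; rfl
      map_smul' := fun _ _ => by rw [map_smul]; rfl })

lemma flipCochain_comp_evalHom {P A : CochainComplex (ModuleCat.{u} R) ℤ} {F : ModuleCat.{u} R}
    {n : ℤ} (x : F →ₗ[R] Cochain P A n) (f : F) :
    (flipCochain x).comp (Cochain.ofHom (evalHom F A f)) (add_zero n) = x f := by
  ext p q hpq t
  rw [Cochain.comp_zero_cochain_v, Cochain.ofHom_v]
  rfl

/-- The linear family of cochains with values in `A` given by a cochain with values in
`Hom_R(F, A)`. -/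
def unflipCochain {P A : CochainComplex (ModuleCat.{u} R) ℤ} {F : ModuleCat.{u} R} {n : ℤ}
    (w : Cochain P (moduleHomComplex F A) n) : F →ₗ[R] Cochain P A n where
  toFun f := w.comp (Cochain.ofHom (evalHom F A f)) (add_zero n)
  map_add' f g := by
    ext p q hpq t
    simp only [Cochain.add_v, Cochain.comp_zero_cochain_v, Cochain.ofHom_v]
    exact map_add (ModuleCat.Hom.hom (w.v p q hpq t : F ⟶ A.X q)) f g
  map_smul' c f := by
    ext p q hpq t
    simp only [Cochain.smul_v, Cochain.comp_zero_cochain_v, Cochain.ofHom_v]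
    exact map_smul (ModuleCat.Hom.hom (w.v p q hpq t : F ⟶ A.X q)) c f

lemma HasCochainLifting.isKPureProjective {P : CochainComplex (ModuleCat.{u} R) ℤ}
    (hP : HasCochainLifting P) : IsKPureProjective P := by
  intro A hA
  rw [isPureAcyclic_iff_isFPAcyclic] at hA ⊢
  intro F _ i j k hij hjk x hx
  let x' : F →ₗ[R] Cochain P A j := x.hom
  obtain ⟨w, hw⟩ := hP _ (hA.moduleHomComplex F) i j k hij hjk (flipCochain x') (by
    refine cochain_ext_evalHom fun f => ?_
    rw [← δ_comp_ofHom, flipCochain_comp_evalHom, Cochain.zero_comp]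
    exact ConcreteCategory.congr_hom hx f)
  refine ⟨ModuleCat.ofHom (unflipCochain w), ?_⟩
  ext f
  change δ i j (unflipCochain w f) = x' f
  rw [← flipCochain_comp_evalHom x' f, ← hw, ← δ_comp_ofHom]
  rfl

/-! ### Closure properties of the lifting properties -/

lemma exists_seq {T : ℕ → Type*} (S : ∀ n, T n → Prop) (r : ∀ n, T n → T (n + 1) → Prop)
    (zero : ∃ y, S 0 y) (succ : ∀ n y, S n y → ∃ y', S (n + 1) y' ∧ r n y y') :
    ∃ y : ∀ n, T n, ∀ n, S n (y n) ∧ r n (y n) (y (n + 1)) := by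
  choose g hg using succ
  let y : ∀ n, { y : T n // S n y } := fun n =>
    Nat.rec ⟨zero.choose, zero.choose_spec⟩ (fun n y => ⟨g n y.1 y.2, (hg n y.1 y.2).1⟩) n
  exact ⟨fun n => (y n).1, fun n => ⟨(y n).2, (hg n _ (y n).2).2⟩⟩

/-- The cocone on a sequence given by a compatible sequence of morphisms. -/
@[simps]
def coconeOfSequence {C : Type*} [Category C] {X : ℕ ⥤ C} {Y : C} (y : ∀ n, X.obj n ⟶ Y)
    (hy : ∀ n, X.map (homOfLE n.le_succ) ≫ y (n + 1) = y n) : Cocone X where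
  pt := Y
  ι := NatTrans.ofSequence y fun n => (hy n).trans (Category.comp_id _).symm

lemma hasLifting_of_finitePresentation (F : ModuleCat.{u} R) [Module.FinitePresentation R F] :
    HasLifting F :=
  fun _ hA => hA F

lemma HasLifting.sigma {ι : Type u} {X : ι → ModuleCat.{u} R} (hX : ∀ a, HasLifting (X a)) :
    HasLifting (∐ X) := by
  intro A hA i j k hij hjk x hx
  choose y hy using fun a => hX a A hA i j k hij hjk (Sigma.ι X a ≫ x) (by simp [hx])
  exact ⟨Sigma.desc y, Sigma.hom_ext _ _ fun a => by simp [hy]⟩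

lemma HasLifting.biprod {X Y : ModuleCat.{u} R} (hX : HasLifting X) (hY : HasLifting Y) :
    HasLifting (X ⊞ Y) := by
  intro A hA i j k hij hjk x hx
  obtain ⟨y, hy⟩ := hX A hA i j k hij hjk (biprod.inl ≫ x) (by simp [hx])
  obtain ⟨z, hz⟩ := hY A hA i j k hij hjk (biprod.inr ≫ x) (by simp [hx])
  exact ⟨biprod.desc y z, biprod.hom_ext' _ _ (by simp [hy]) (by simp [hz])⟩

/-- Lifts can be chosen compatibly: the discrepancy between a lift at stage `n` and the restriction
of one at stage `n + 1` is killed by `d`, and extends along a retraction to a correction. -/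
lemma HasLifting.of_isColimit {X : ℕ ⥤ ModuleCat.{u} R} {c : Cocone X} (hc : IsColimit c)
    (hX : ∀ n, HasLifting (X.obj n)) (hs : ∀ n : ℕ, IsSplitMono (X.map (homOfLE n.le_succ))) :
    HasLifting c.pt := by
  intro A hA i j k hij hjk x hx
  have hxn : ∀ n, (c.ι.app n ≫ x) ≫ A.d j k = 0 := by simp [hx]
  obtain ⟨y, hy⟩ := exists_seq (T := fun n => X.obj n ⟶ A.X i)
    (fun n y => y ≫ A.d i j = c.ι.app n ≫ x)
    (fun n y y' => X.map (homOfLE n.le_succ) ≫ y' = y)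
    (hX 0 A hA i j k hij hjk _ (hxn 0)) (by
      intro n y hy
      obtain ⟨y', hy'⟩ := hX (n + 1) A hA i j k hij hjk _ (hxn (n + 1))
      have := hs n
      refine ⟨y' + retraction (X.map (homOfLE n.le_succ)) ≫
        (y - X.map (homOfLE n.le_succ) ≫ y'), ?_, ?_⟩
      · have : (y - X.map (homOfLE n.le_succ) ≫ y') ≫ A.d i j = 0 := by
          rw [Preadditive.sub_comp, Category.assoc, hy, hy', Cocone.w_assoc, sub_self]
        rw [Preadditive.add_comp, Category.assoc, this, hy', comp_zero, add_zero]
      · simp)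
  refine ⟨hc.desc (coconeOfSequence y fun n => (hy n).2), hc.hom_ext fun n => ?_⟩
  exact (Category.assoc _ _ _).symm.trans
    ((congrArg (· ≫ A.d i j) (hc.fac _ n)).trans (hy n).1)

/-- Without a differential on `Q`, `δ` is just composition with the differential of `A`, and each
component can be lifted separately. -/
lemma HasCochainLifting.of_d_eq_zero {Q : CochainComplex (ModuleCat.{u} R) ℤ}
    (hd : ∀ i j, Q.d i j = 0) (hQ : ∀ i, HasLifting (Q.X i)) : HasCochainLifting Q := by
  intro A hA i j k hij hjk z hz
  have h : ∀ p q (hpq : p + i = q), ∃ y : Q.X p ⟶ A.X q,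
      y ≫ A.d q (q + 1) = z.v p (q + 1) (by lia) := by
    intro p q hpq
    refine hQ p A hA q (q + 1) (q + 1 + 1) rfl rfl _ ?_
    have := Cochain.congr_v hz p (q + 1 + 1) (by lia)
    rwa [δ_v j k hjk _ p (q + 1 + 1) (by lia) (q + 1) (p + 1) (by lia) rfl, hd, zero_comp,
      smul_zero, add_zero] at this
  choose y hy using h
  refine ⟨Cochain.mk y, ?_⟩
  ext1 p q hpq
  obtain rfl : q = (p + i) + 1 := by lia
  rw [δ_v i j hij _ p (p + i + 1) (by lia) (p + i) (p + 1) (by lia) rfl, hd, zero_comp, smul_zero,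
    add_zero, Cochain.mk_v, hy]

section

variable {K L C : CochainComplex (ModuleCat.{u} R) ℤ} (f : K ⟶ L) (g : L ⟶ C)
  (r : ∀ i, L.X i ⟶ K.X i) (s : ∀ i, C.X i ⟶ L.X i)

lemma ofHom_comp_ofHoms_retraction (hfr : ∀ i, f.f i ≫ r i = 𝟙 _) :
    (Cochain.ofHom f).comp (Cochain.ofHoms r) (add_zero 0) = Cochain.ofHom (𝟙 K) := by
  ext p
  simp [hfr]

lemma ofHom_comp_ofHoms_section (hid : ∀ i, r i ≫ f.f i + g.f i ≫ s i = 𝟙 _)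
    {A : CochainComplex (ModuleCat.{u} R) ℤ} {n : ℤ} (z : Cochain L A n)
    (hz : (Cochain.ofHom f).comp z (zero_add n) = 0) :
    (Cochain.ofHom g).comp ((Cochain.ofHoms s).comp z (zero_add n)) (zero_add n) = z := by
  ext1 p q hpq
  have h := Cochain.congr_v hz p q hpq
  simp only [Cochain.zero_cochain_comp_v, Cochain.ofHom_v, Cochain.ofHoms_v,
    Cochain.zero_v] at h ⊢
  conv_rhs => rw [← Category.id_comp (z.v p q hpq), ← hid]
  simp [h]

lemma cochain_ofHom_comp_injective (hsg : ∀ i, s i ≫ g.f i = 𝟙 _)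
    {A : CochainComplex (ModuleCat.{u} R) ℤ} {n : ℤ} {z w : Cochain C A n}
    (h : (Cochain.ofHom g).comp z (zero_add n) = (Cochain.ofHom g).comp w (zero_add n)) :
    z = w := by
  ext1 p q hpq
  have h := congrArg (fun t => s p ≫ t) (Cochain.congr_v h p q hpq)
  simpa [reassoc_of% (hsg p)] using h

/-- The degreewise splitting makes the sequence of Hom complexes exact. Subtracting a coboundary
makes `z` vanish on `K`; it then comes from a cocycle on `C`. The maps `r` and `s` need not commute
with differentials and enter only as 0-cochains. -/
lemma HasCochainLifting.extension (hfr : ∀ i, f.f i ≫ r i = 𝟙 _) (hsg : ∀ i, s i ≫ g.f i = 𝟙 _)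
    (hid : ∀ i, r i ≫ f.f i + g.f i ≫ s i = 𝟙 _) (hK : HasCochainLifting K)
    (hC : HasCochainLifting C) : HasCochainLifting L := by
  intro A hA i j k hij hjk z hz
  obtain ⟨y, hy⟩ := hK A hA i j k hij hjk ((Cochain.ofHom f).comp z (zero_add j)) (by
    rw [δ_ofHom_comp, hz, Cochain.comp_zero])
  let w := z - δ i j ((Cochain.ofHoms r).comp y (zero_add i))
  have hw : (Cochain.ofHom f).comp w (zero_add j) = 0 := by
    rw [Cochain.comp_sub, ← δ_ofHom_comp, ← Cochain.comp_assoc_of_first_is_zero_cochain,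
      ofHom_comp_ofHoms_retraction f r hfr, Cochain.id_comp, hy, sub_self]
  have hw' := ofHom_comp_ofHoms_section f g r s hid w hw
  obtain ⟨t, ht⟩ := hC A hA i j k hij hjk ((Cochain.ofHoms s).comp w (zero_add j)) (by
    apply cochain_ofHom_comp_injective g s hsg
    rw [← δ_ofHom_comp, hw', δ_sub, hz, δ_δ, sub_self, Cochain.comp_zero])
  refine ⟨(Cochain.ofHoms r).comp y (zero_add i) + (Cochain.ofHom g).comp t (zero_add i), ?_⟩
  rw [δ_add, δ_ofHom_comp, ht, hw']
  simp [w]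

lemma HasCochainLifting.quotient (hfg : f ≫ g = 0) (hfr : ∀ i, f.f i ≫ r i = 𝟙 _)
    (hsg : ∀ i, s i ≫ g.f i = 𝟙 _)
    (hid : ∀ i, r i ≫ f.f i + g.f i ≫ s i = 𝟙 _) (hK : HasCochainLifting K)
    (hL : HasCochainLifting L) : HasCochainLifting C := by
  intro A hA i j k hij hjk z hz
  obtain ⟨y, hy⟩ := hL A hA i j k hij hjk ((Cochain.ofHom g).comp z (zero_add j)) (by
    rw [δ_ofHom_comp, hz, Cochain.comp_zero])
  obtain ⟨t, ht⟩ := hK A hA (i - 1) i j (by lia) hij ((Cochain.ofHom f).comp y (zero_add i)) (by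
    rw [δ_ofHom_comp, hy, ← Cochain.comp_assoc_of_first_is_zero_cochain, ← Cochain.ofHom_comp, hfg,
      Cochain.ofHom_zero, Cochain.zero_comp])
  let w := y - δ (i - 1) i ((Cochain.ofHoms r).comp t (zero_add _))
  have hw : (Cochain.ofHom f).comp w (zero_add i) = 0 := by
    rw [Cochain.comp_sub, ← δ_ofHom_comp, ← Cochain.comp_assoc_of_first_is_zero_cochain,
      ofHom_comp_ofHoms_retraction f r hfr, Cochain.id_comp, ht, sub_self]
  refine ⟨(Cochain.ofHoms s).comp w (zero_add i), ?_⟩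
  apply cochain_ofHom_comp_injective g s hsg
  rw [← δ_ofHom_comp, ofHom_comp_ofHoms_section f g r s hid w hw, δ_sub, hy, δ_δ, sub_zero]

end

/-- The discrepancy of two successive lifts is a cocycle, hence `δ t`. Extending `t` by degreewise
retractions and subtracting its coboundary makes the lifts compatible without changing their `δ`. -/
lemma HasCochainLifting.of_isColimit {P : ℕ ⥤ CochainComplex (ModuleCat.{u} R) ℤ} {c : Cocone P}
    (hc : IsColimit c) (hP : ∀ n, HasCochainLifting (P.obj n))
    (hs : ∀ (n : ℕ) (i : ℤ), IsSplitMono ((P.map (homOfLE n.le_succ)).f i)) :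
    HasCochainLifting c.pt := by
  intro A hA i j k hij hjk z hz
  let zn (n : ℕ) : Cochain (P.obj n) A j := (Cochain.ofHom (c.ι.app n)).comp z (zero_add j)
  have hzn : ∀ n, δ j k (zn n) = 0 := fun n => by rw [δ_ofHom_comp, hz, Cochain.comp_zero]
  obtain ⟨w, hw⟩ := exists_seq (T := fun n => Cochain (P.obj n) A i)
    (fun n w => δ i j w = zn n)
    (fun n w w' => (Cochain.ofHom (P.map (homOfLE n.le_succ))).comp w' (zero_add i) = w)
    (hP 0 A hA i j k hij hjk _ (hzn 0)) (by
      intro n w hw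
      obtain ⟨w', hw'⟩ := hP (n + 1) A hA i j k hij hjk _ (hzn (n + 1))
      obtain ⟨t, ht⟩ := hP n A hA (i - 1) i j (by lia) hij
        ((Cochain.ofHom (P.map (homOfLE n.le_succ))).comp w' (zero_add i) - w) (by
          rw [δ_sub, δ_ofHom_comp, hw, hw', ← Cochain.comp_assoc_of_first_is_zero_cochain,
            ← Cochain.ofHom_comp, Cocone.w, sub_self])
      refine ⟨w' - δ (i - 1) i ((Cochain.ofHoms fun p =>
        have := hs n p; retraction ((P.map (homOfLE n.le_succ)).f p)).comp t (zero_add _)), ?_, ?_⟩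
      · rw [δ_sub, δ_δ, hw', sub_zero]
      · rw [Cochain.comp_sub, ← δ_ofHom_comp, ← Cochain.comp_assoc_of_first_is_zero_cochain,
          ofHom_comp_ofHoms_retraction _ _ (fun p => have := hs n p; IsSplitMono.id _),
          Cochain.id_comp, ht, sub_sub_cancel])
  have hcp (p : ℤ) := isColimitOfPreserves (HomologicalComplex.eval _ _ p) hc
  let w' : Cochain c.pt A i := Cochain.mk fun p q hpq => (hcp p).desc
    (coconeOfSequence (X := P ⋙ HomologicalComplex.eval _ _ p) (fun n => (w n).v p q hpq)
      fun n => by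
        have := Cochain.congr_v (hw n).2 p q hpq
        rwa [Cochain.zero_cochain_comp_v, Cochain.ofHom_v] at this)
  have hw' : ∀ n, (Cochain.ofHom (c.ι.app n)).comp w' (zero_add i) = w n := by
    intro n
    ext1 p q hpq
    rw [Cochain.zero_cochain_comp_v, Cochain.ofHom_v]
    exact (hcp p).fac _ n
  refine ⟨w', ?_⟩
  ext1 p q hpq
  refine (hcp p).hom_ext fun n => ?_
  have := Cochain.congr_v ((δ_ofHom_comp (c.ι.app n) w' j).symm.trans
    ((congrArg (δ i j) (hw' n)).trans (hw n).1)) p q hpq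
  rwa [Cochain.zero_cochain_comp_v, Cochain.ofHom_v, Cochain.zero_cochain_comp_v,
    Cochain.ofHom_v] at this

/-! ### Exactness of mapping cones -/

section Cone

variable {P N : CochainComplex (ModuleCat.{u} R) ℤ}

/-- The pair `(p, q)` is a cocycle of the mapping cone of `g`, parametrized by `F`. -/
def IsConeCocycle (g : P ⟶ N) {F : ModuleCat.{u} R} {j : ℤ} (p : F ⟶ P.X (j + 1))
    (q : F ⟶ N.X j) : Prop :=
  p ≫ P.d (j + 1) (j + 1 + 1) = 0 ∧ p ≫ g.f (j + 1) + q ≫ N.d j (j + 1) = 0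

/-- The pair `(p, q)` is a coboundary of the mapping cone of `g`, parametrized by `F`. -/
def IsConeBoundary (g : P ⟶ N) {F : ModuleCat.{u} R} {j : ℤ} (p : F ⟶ P.X (j + 1))
    (q : F ⟶ N.X j) : Prop :=
  ∃ (p' : F ⟶ P.X j) (q' : F ⟶ N.X (j - 1)), p' ≫ P.d j (j + 1) = -p ∧
    p' ≫ g.f j + q' ≫ N.d (j - 1) j = q

/-- All cocycles of the mapping cone of `g` parametrized by finitely presented modules are
coboundaries. -/
def IsConeExact (g : P ⟶ N) : Prop :=
  ∀ (F : ModuleCat.{u} R) [Module.FinitePresentation R F] (j : ℤ) (p : F ⟶ P.X (j + 1))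
    (q : F ⟶ N.X j), IsConeCocycle g p q → IsConeBoundary g p q

open CochainComplex in
-- In degree `j` the cone is `P.X (j + 1) ⊞ N.X j` with differential `(p, q) ↦ (-d p, g p + d q)`.
lemma IsConeExact.isPureQuasiIso {g : P ⟶ N} (hg : IsConeExact g) : IsPureQuasiIso g := by
  refine isPureAcyclic_iff_isFPAcyclic.2 ?_
  intro F _ i j k hij hjk x hx
  obtain rfl : i = j - 1 := by lia
  subst hjk
  have h₁ := congrArg (fun t => t ≫ (mappingCone.fst g).1.v (j + 1) (j + 1 + 1) rfl) hx
  have h₂ := congrArg (fun t => t ≫ (mappingCone.snd g).v (j + 1) (j + 1) (add_zero _)) hx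
  simp only [Category.assoc, mappingCone.d_fst_v g j (j + 1) (j + 1 + 1) rfl rfl,
    mappingCone.d_snd_v g j (j + 1) rfl, zero_comp, Preadditive.comp_neg, Preadditive.comp_add,
    neg_eq_zero] at h₁ h₂
  obtain ⟨p', q', hp', hq'⟩ := hg F j (x ≫ (mappingCone.fst g).1.v j (j + 1) rfl)
    (x ≫ (mappingCone.snd g).v j j (add_zero j)) ⟨by simpa using h₁, by simpa using h₂⟩
  refine ⟨p' ≫ (mappingCone.inl g).v j (j - 1) (by lia) + q' ≫ (mappingCone.inr g).f (j - 1), ?_⟩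
  rw [mappingCone.ext_to_iff g j (j + 1) rfl]
  simp only [Preadditive.add_comp, Category.assoc,
    mappingCone.d_fst_v g (j - 1) j (j + 1) (by lia) rfl,
    mappingCone.d_snd_v g (j - 1) j (by lia), Preadditive.comp_neg, Preadditive.comp_add]
  constructor
  · simp [hp']
  · simpa using hq'

end Cone

/-! ### Finitely presented modules and sequential colimits -/

/-- Morphisms from finitely presented modules to the terms of the point of the cocone are
computed as in a filtered colimit. -/
structure IsFPColimit {X : ℕ ⥤ CochainComplex (ModuleCat.{u} R) ℤ} (c : Cocone X) : Prop where
  exists_lift : ∀ (F : ModuleCat.{u} R) [Module.FinitePresentation R F] (i : ℤ)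
    (x : F ⟶ c.pt.X i), ∃ (n : ℕ) (y : F ⟶ (X.obj n).X i), y ≫ (c.ι.app n).f i = x
  exists_eq_zero : ∀ (F : ModuleCat.{u} R) [Module.FinitePresentation R F] (i : ℤ) (n : ℕ)
    (x : F ⟶ (X.obj n).X i), x ≫ (c.ι.app n).f i = 0 →
      ∃ (m : ℕ) (h : n ≤ m), x ≫ (X.map (homOfLE h)).f i = 0

section

variable {X : ℕ ⥤ ModuleCat.{u} R} {c : Cocone X}

instance : PreservesColimitsOfShape ℕ (forget (ModuleCat.{u} R)) :=
  have := preservesFilteredColimitsOfSize_shrink.{0, u, 0, u} (forget (ModuleCat.{u} R))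
  PreservesFilteredColimitsOfSize.preserves_filtered_colimits ℕ

lemma exists_map_eq_zero_of_finite (hc : IsColimit c) {ι : Type*} [Finite ι] {n : ℕ}
    (x : ι → X.obj n) (hx : ∀ a, c.ι.app n (x a) = 0) :
    ∃ (m : ℕ) (h : n ≤ m), ∀ a, X.map (homOfLE h) (x a) = 0 := by
  have h : ∀ a, ∃ (m : ℕ) (h : n ≤ m), X.map (homOfLE h) (x a) = 0 := by
    intro a
    obtain ⟨k, f, g, h⟩ := Concrete.isColimit_exists_of_rep_eq X hc (x a) (0 : X.obj n)
      (by rw [hx, map_zero])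
    exact ⟨k, leOfHom f, by rw [map_zero] at h; exact h⟩
  choose m hm hm' using h
  obtain ⟨k, hk⟩ := Finite.exists_le m
  obtain ⟨k, hk, hnk⟩ : ∃ k, (∀ a, m a ≤ k) ∧ n ≤ k :=
    ⟨max n k, fun a => (hk a).trans (le_max_right _ _), le_max_left _ _⟩
  refine ⟨k, hnk, fun a => ?_⟩
  rw [← homOfLE_comp (hm a) (hk a), X.map_comp, ModuleCat.comp_apply, hm', map_zero]

lemma exists_map_eq_of_finite (hc : IsColimit c) {ι : Type*} [Finite ι] (x : ι → c.pt) :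
    ∃ (n : ℕ) (y : ι → X.obj n), ∀ a, c.ι.app n (y a) = x a := by
  choose n y hy using fun a => Concrete.isColimit_exists_rep X hc (x a)
  obtain ⟨k, hk⟩ := Finite.exists_le n
  refine ⟨k, fun a => X.map (homOfLE (hk a)) (y a), fun a => ?_⟩
  rw [← ModuleCat.comp_apply, Cocone.w, hy]

lemma exists_comp_map_eq_zero (hc : IsColimit c) (F : ModuleCat.{u} R) [Module.Finite R F] {n : ℕ}
    (x : F ⟶ X.obj n) (hx : x ≫ c.ι.app n = 0) :
    ∃ (m : ℕ) (h : n ≤ m), x ≫ X.map (homOfLE h) = 0 := by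
  obtain ⟨k, f, hf⟩ := Module.Finite.exists_fin (R := R) (M := F)
  obtain ⟨m, h, hm⟩ := exists_map_eq_zero_of_finite hc (fun a => x (f a)) fun a => by
    rw [← ModuleCat.comp_apply, hx]; rfl
  refine ⟨m, h, ModuleCat.hom_ext (LinearMap.ext_on_range hf fun a => hm a)⟩

/-- The images of finitely many generators lift to one stage, and the finitely many relations hold
at a later one. -/
lemma exists_comp_ι_eq (hc : IsColimit c) (F : ModuleCat.{u} R) [Module.FinitePresentation R F]
    (x : F ⟶ c.pt) : ∃ (n : ℕ) (y : F ⟶ X.obj n), y ≫ c.ι.app n = x := by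
  obtain ⟨a, b, f, g, hf, hfg⟩ := Module.FinitePresentation.exists_fin' R F
  obtain ⟨n, y, hy⟩ := exists_map_eq_of_finite hc fun l => x (f (Pi.single l 1))
  obtain ⟨m, h, hm⟩ := exists_map_eq_zero_of_finite hc
    (fun e => ∑ l, g (Pi.single e 1) l • y l) fun e => by
      have : f (g (Pi.single e 1)) = 0 := (hfg _).2 ⟨_, rfl⟩
      rw [← sum_smul_apply_single f] at this
      simpa [hy] using congrArg x this
  obtain ⟨t, ht⟩ := exists_linearMap_of_exact hf hfg (fun l => X.map (homOfLE h) (y l))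
    (fun e => by simpa using hm e)
  refine ⟨m, ModuleCat.ofHom t, ModuleCat.hom_ext (LinearMap.ext fun z => ?_)⟩
  obtain ⟨d, rfl⟩ := hf z
  rw [← sum_smul_apply_single f, map_sum, map_sum]
  refine Finset.sum_congr rfl fun l _ => ?_
  rw [map_smul, map_smul]
  congr 1
  refine (congrArg (c.ι.app m) (ht l)).trans ?_
  rw [← hy l, ← ModuleCat.comp_apply, Cocone.w]

end

lemma isFPColimit_of_isColimit {X : ℕ ⥤ CochainComplex (ModuleCat.{u} R) ℤ} {c : Cocone X}
    (hc : IsColimit c) : IsFPColimit c where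
  exists_lift F _ i x :=
    exists_comp_ι_eq (isColimitOfPreserves (HomologicalComplex.eval _ _ i) hc) F x
  exists_eq_zero F _ i _ x hx :=
    exists_comp_map_eq_zero (isColimitOfPreserves (HomologicalComplex.eval _ _ i) hc) F x hx

/-- A cocycle in the limit cone is represented at a finite stage and satisfies the cocycle equations
at a later one. Bounding it only at a still later stage `m` suffices, and that is what attaching
cells provides. -/
lemma isConeExact_of_isFPColimit {P N : ℕ ⥤ CochainComplex (ModuleCat.{u} R) ℤ} (φ : P ⟶ N)
    {c : Cocone P} {c' : Cocone N} (hc : IsFPColimit c) (hc' : IsFPColimit c') (g : c.pt ⟶ c'.pt)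
    (hg : ∀ n, c.ι.app n ≫ g = φ.app n ≫ c'.ι.app n)
    (h : ∀ (n : ℕ) (F : ModuleCat.{u} R) [Module.FinitePresentation R F] (j : ℤ)
      (p : F ⟶ (P.obj n).X (j + 1)) (q : F ⟶ (N.obj n).X j), IsConeCocycle (φ.app n) p q →
        ∃ (m : ℕ) (h : n ≤ m), IsConeBoundary (φ.app m) (p ≫ (P.map (homOfLE h)).f (j + 1))
          (q ≫ (N.map (homOfLE h)).f j)) : IsConeExact g := by
  have hgf : ∀ n i, (c.ι.app n).f i ≫ g.f i = (φ.app n).f i ≫ (c'.ι.app n).f i := fun n i => by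
    rw [← HomologicalComplex.comp_f, hg, HomologicalComplex.comp_f]
  have hcw : ∀ {m n : ℕ} (h : m ≤ n) i, (P.map (homOfLE h)).f i ≫ (c.ι.app n).f i =
      (c.ι.app m).f i := fun h i => by
    rw [← HomologicalComplex.comp_f, Cocone.w]
  have hcw' : ∀ {m n : ℕ} (h : m ≤ n) i, (N.map (homOfLE h)).f i ≫ (c'.ι.app n).f i =
      (c'.ι.app m).f i := fun h i => by
    rw [← HomologicalComplex.comp_f, Cocone.w]
  have hφ : ∀ {m n : ℕ} (h : m ≤ n) i, (P.map (homOfLE h)).f i ≫ (φ.app n).f i =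
      (φ.app m).f i ≫ (N.map (homOfLE h)).f i := fun h i => by
    rw [← HomologicalComplex.comp_f, φ.naturality, HomologicalComplex.comp_f]
  have hd : ∀ n i j, (c.ι.app n).f i ≫ c.pt.d i j = (P.obj n).d i j ≫ (c.ι.app n).f j :=
    fun n => (c.ι.app n).comm
  have hd' : ∀ n i j, (c'.ι.app n).f i ≫ c'.pt.d i j = (N.obj n).d i j ≫ (c'.ι.app n).f j :=
    fun n => (c'.ι.app n).comm
  intro F _ j p q hpq
  obtain ⟨n₁, p₁, rfl⟩ := hc.exists_lift F _ p
  obtain ⟨n₂, q₁, rfl⟩ := hc'.exists_lift F _ q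
  obtain ⟨n, p₂, q₂, hp₂, hq₂⟩ : ∃ (n : ℕ) (p₂ : F ⟶ (P.obj n).X (j + 1))
      (q₂ : F ⟶ (N.obj n).X j), p₂ ≫ (c.ι.app n).f _ = p₁ ≫ (c.ι.app n₁).f _ ∧
        q₂ ≫ (c'.ι.app n).f _ = q₁ ≫ (c'.ι.app n₂).f _ :=
    ⟨max n₁ n₂, p₁ ≫ (P.map (homOfLE (le_max_left _ _))).f _,
      q₁ ≫ (N.map (homOfLE (le_max_right _ _))).f _, by simp [hcw], by simp [hcw']⟩
  rw [← hp₂, ← hq₂] at hpq ⊢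
  obtain ⟨hp, hq⟩ := hpq
  obtain ⟨m₁, h₁, hm₁⟩ := hc.exists_eq_zero F _ n (p₂ ≫ (P.obj n).d (j + 1) (j + 1 + 1))
    (by simpa using hp)
  obtain ⟨m₂, h₂, hm₂⟩ := hc'.exists_eq_zero F _ n
    (p₂ ≫ (φ.app n).f (j + 1) + q₂ ≫ (N.obj n).d j (j + 1)) (by simpa [hgf] using hq)
  have hl := le_max_left m₁ m₂
  have hr := le_max_right m₁ m₂
  obtain ⟨m, h₃, p', q', hp', hq'⟩ := h (max m₁ m₂) F j
    (p₂ ≫ (P.map (homOfLE (h₁.trans hl))).f _) (q₂ ≫ (N.map (homOfLE (h₁.trans hl))).f _) (by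
      constructor
      · rw [← homOfLE_comp h₁ hl, P.map_comp]
        simp only [Category.assoc, HomologicalComplex.comp_f, HomologicalComplex.Hom.comm] at hm₁ ⊢
        rw [HomologicalComplex.Hom.comm_assoc, reassoc_of% hm₁, zero_comp]
      · rw [Category.assoc, hφ, Category.assoc, HomologicalComplex.Hom.comm, ← Category.assoc,
          ← Category.assoc, ← Preadditive.add_comp, ← homOfLE_comp h₂ hr, N.map_comp,
          HomologicalComplex.comp_f, reassoc_of% hm₂, zero_comp])
  refine ⟨p' ≫ (c.ι.app m).f j, q' ≫ (c'.ι.app m).f (j - 1), ?_, ?_⟩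
  · rw [Category.assoc, hd, reassoc_of% hp']
    simp [hcw]
  · rw [Category.assoc, Category.assoc, hgf, hd', ← Category.assoc, ← Category.assoc,
      ← Preadditive.add_comp, hq']
    simp [hcw']

/-! ### Attaching cells -/

section Attach

variable (R) in
/-- A set of indices for the isomorphism classes of finitely presented modules. -/
structure FPIndex : Type u where
  /-- the number of generators -/
  card : ℕ
  /-- the submodule of relations -/
  relations : Submodule R (Fin card → R)
  fg : relations.FG

instance (s : FPIndex R) : Module.FinitePresentation R ((Fin s.card → R) ⧸ s.relations) :=
  Module.finitePresentation_of_surjective s.relations.mkQ (Submodule.mkQ_surjective _)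
    (by rw [Submodule.ker_mkQ]; exact s.fg)

/-- The finitely presented module attached to an index. -/
def FPIndex.module (s : FPIndex R) : ModuleCat.{u} R :=
  ModuleCat.of R ((Fin s.card → R) ⧸ s.relations)

instance (s : FPIndex R) : Module.FinitePresentation R s.module :=
  inferInstanceAs (Module.FinitePresentation R ((Fin s.card → R) ⧸ s.relations))

lemma FPIndex.exists_iso (F : ModuleCat.{u} R) [Module.FinitePresentation R F] :
    ∃ s : FPIndex R, Nonempty (F ≅ s.module) := by
  obtain ⟨n, K, e, hK⟩ := Module.FinitePresentation.exists_fin R F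
  exact ⟨⟨n, K, hK⟩, ⟨e.toModuleIso⟩⟩

variable {P N : CochainComplex (ModuleCat.{u} R) ℤ}

section Cells

variable (g : P ⟶ N)

/-- The nonzero cocycles of the mapping cone of `g` in degree `j`, parametrized by finitely
presented modules. -/
structure Cell (j : ℤ) : Type u where
  /-- the index of the parametrizing module -/
  index : FPIndex R
  /-- the first component of the cocycle -/
  fst : index.module ⟶ P.X (j + 1)
  /-- the second component of the cocycle -/
  snd : index.module ⟶ N.X j
  isConeCocycle : IsConeCocycle g fst snd
  ne_zero : ¬ (fst = 0 ∧ snd = 0)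

/-- The direct sum of the finitely presented modules parametrizing the cells in degree `j`. -/
def cellModule (j : ℤ) : ModuleCat.{u} R := ∐ fun c : Cell g j => c.index.module

/-- The inclusion of a cell. -/
def cellι {j : ℤ} (c : Cell g j) : c.index.module ⟶ cellModule g j :=
  Sigma.ι (fun c : Cell g j => c.index.module) c

/-- The first component of the tautological cocycle on the cells. -/
def cellFst (j : ℤ) : cellModule g j ⟶ P.X (j + 1) := Limits.Sigma.desc fun c => c.fst

/-- The second component of the tautological cocycle on the cells. -/
def cellSnd (j : ℤ) : cellModule g j ⟶ N.X j := Limits.Sigma.desc fun c => c.snd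

variable {g} in
lemma cellModule_hom_ext {j : ℤ} {Y : ModuleCat.{u} R} {x y : cellModule g j ⟶ Y}
    (h : ∀ c, cellι g c ≫ x = cellι g c ≫ y) : x = y :=
  Sigma.hom_ext _ _ h

lemma cellι_fst {j : ℤ} (c : Cell g j) : cellι g c ≫ cellFst g j = c.fst :=
  Sigma.ι_desc _ _

lemma cellι_snd {j : ℤ} (c : Cell g j) : cellι g c ≫ cellSnd g j = c.snd :=
  Sigma.ι_desc _ _

lemma cellFst_d (j : ℤ) : cellFst g j ≫ P.d (j + 1) (j + 1 + 1) = 0 :=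
  cellModule_hom_ext fun c => by
    rw [← Category.assoc, cellι_fst, c.isConeCocycle.1, comp_zero]

lemma cellFst_f_add (j : ℤ) :
    cellFst g j ≫ g.f (j + 1) + cellSnd g j ≫ N.d j (j + 1) = 0 :=
  cellModule_hom_ext fun c => by
    rw [Preadditive.comp_add, ← Category.assoc, cellι_fst, ← Category.assoc, cellι_snd,
      c.isConeCocycle.2, comp_zero]

lemma hasLifting_cellModule (j : ℤ) : HasLifting (cellModule g j) :=
  HasLifting.sigma fun c => hasLifting_of_finitePresentation c.index.module

/-- Zero cocycles are excluded from the cells precisely for this: attaching cells preserves upper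
bounds on degrees. -/
lemma isZero_cellModule {j : ℤ} (hP : IsZero (P.X (j + 1))) (hN : IsZero (N.X j)) :
    IsZero (cellModule g j) := by
  rw [IsZero.iff_id_eq_zero]
  exact cellModule_hom_ext fun c => (c.ne_zero ⟨hP.eq_of_tgt _ _, hN.eq_of_tgt _ _⟩).elim

/-- The complex of cells, with zero differential. -/
def cellComplex : CochainComplex (ModuleCat.{u} R) ℤ where
  X := cellModule g
  d _ _ := 0

/-- The differential of `attachCells`. -/
def attachD (j : ℤ) : P.X j ⊞ cellModule g j ⟶ P.X (j + 1) ⊞ cellModule g (j + 1) :=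
  biprod.desc (P.d j (j + 1)) (-cellFst g j) ≫ biprod.inl

lemma inl_attachD (j : ℤ) : biprod.inl ≫ attachD g j = P.d j (j + 1) ≫ biprod.inl := by
  simp [attachD]

/-- The sign is that of the mapping cone: a cell `(p, q)` gets boundary `-p` and is sent to `q` in
`N`. -/
lemma inr_attachD (j : ℤ) : biprod.inr ≫ attachD g j = -cellFst g j ≫ biprod.inl := by
  simp [attachD]

lemma attachD_attachD (j : ℤ) : attachD g j ≫ attachD g (j + 1) = 0 := by
  refine biprod.hom_ext' _ _ ?_ ?_
  · simp [attachD]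
  · simp [attachD, reassoc_of% (cellFst_d g j)]

lemma attachD_snd (j : ℤ) : attachD g j ≫ biprod.snd = 0 := by
  simp [attachD]

lemma attachD_desc (j : ℤ) : biprod.desc (g.f j) (cellSnd g j) ≫ N.d j (j + 1) =
    attachD g j ≫ biprod.desc (g.f (j + 1)) (cellSnd g (j + 1)) := by
  refine biprod.hom_ext' _ _ ?_ ?_
  · simp [attachD]
  · simpa [attachD, eq_neg_iff_add_eq_zero, add_comm] using cellFst_f_add g j

/-- The complex obtained from `P` by attaching all the cells. -/
def attachCells : CochainComplex (ModuleCat.{u} R) ℤ :=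
  CochainComplex.of (fun j => P.X j ⊞ cellModule g j) (attachD g) (attachD_attachD g)

lemma attachCells_d (j : ℤ) : (attachCells g).d j (j + 1) = attachD g j :=
  CochainComplex.of_d (fun j => P.X j ⊞ cellModule g j) (attachD g) j

/-- The inclusion of `P` in the complex obtained by attaching cells. -/
def attachι : P ⟶ attachCells g where
  f j := (biprod.inl : P.X j ⟶ P.X j ⊞ cellModule g j)
  comm' i j hij := by
    obtain rfl : i + 1 = j := hij
    rw [attachCells_d]
    exact inl_attachD g i

/-- The extension of `g` to the complex obtained by attaching cells. -/
def attachDesc : attachCells g ⟶ N where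
  f j := (biprod.desc (g.f j) (cellSnd g j) : P.X j ⊞ cellModule g j ⟶ N.X j)
  comm' i j hij := by
    obtain rfl : i + 1 = j := hij
    rw [attachCells_d]
    exact attachD_desc g i

/-- The projection to the complex of cells. -/
def attachπ : attachCells g ⟶ cellComplex g where
  f j := (biprod.snd : P.X j ⊞ cellModule g j ⟶ cellModule g j)
  comm' i j hij := by
    obtain rfl : i + 1 = j := hij
    rw [attachCells_d]
    exact comp_zero.trans (attachD_snd g i).symm

lemma attachι_desc : attachι g ≫ attachDesc g = g := by
  ext1 j
  exact biprod.inl_desc _ _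

instance (j : ℤ) : IsSplitMono ((attachι g).f j) :=
  inferInstanceAs (IsSplitMono (biprod.inl : P.X j ⟶ P.X j ⊞ cellModule g j))

lemma hasLifting_attachCells (hP : ∀ j, HasLifting (P.X j)) (j : ℤ) :
    HasLifting ((attachCells g).X j) :=
  (hP j).biprod (hasLifting_cellModule g j)

/-- Attaching cells is a degreewise split extension of a complex with zero differential by `P`. -/
lemma hasCochainLifting_attachCells (hP : HasCochainLifting P) :
    HasCochainLifting (attachCells g) :=
  HasCochainLifting.extension (attachι g) (attachπ g)
    (fun j => (biprod.fst : P.X j ⊞ cellModule g j ⟶ P.X j))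
    (fun j => (biprod.inr : cellModule g j ⟶ P.X j ⊞ cellModule g j))
    (fun _ => biprod.inl_fst) (fun _ => biprod.inr_snd) (fun _ => biprod.total) hP
    (HasCochainLifting.of_d_eq_zero (fun _ _ => rfl) (hasLifting_cellModule g))

lemma isZero_attachCells {j : ℤ} (hP : IsZero (P.X j)) (hP' : IsZero (P.X (j + 1)))
    (hN : IsZero (N.X j)) : IsZero ((attachCells g).X j) :=
  (biprod_isZero_iff (P.X j) (cellModule g j)).2 ⟨hP, isZero_cellModule g hP' hN⟩

lemma isConeBoundary_attachCells (F : ModuleCat.{u} R) [Module.FinitePresentation R F] (j : ℤ)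
    (p : F ⟶ P.X (j + 1)) (q : F ⟶ N.X j) (h : IsConeCocycle g p q) :
    IsConeBoundary (attachDesc g) (p ≫ (attachι g).f (j + 1)) q := by
  -- The zero cocycle is not a cell; any other is bounded by the inclusion of its own cell, with
  -- zero component in `N`.
  by_cases hpq : p = 0 ∧ q = 0
  · exact ⟨0, 0, by simp [hpq.1], by simp [hpq.2]⟩
  obtain ⟨s, ⟨e⟩⟩ := FPIndex.exists_iso F
  let c : Cell g j :=
    { index := s
      fst := e.inv ≫ p
      snd := e.inv ≫ q
      isConeCocycle := ⟨by simp [h.1], by simpa using congrArg (fun t => e.inv ≫ t) h.2⟩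
      ne_zero := by simpa using hpq }
  let y : F ⟶ cellModule g j := e.hom ≫ cellι g c
  have hp : y ≫ cellFst g j = p := by
    rw [Category.assoc, cellι_fst, e.hom_inv_id_assoc]
  have hq : y ≫ cellSnd g j = q := by
    rw [Category.assoc, cellι_snd, e.hom_inv_id_assoc]
  refine ⟨y ≫ (biprod.inr : _ ⟶ P.X j ⊞ cellModule g j), 0, ?_, ?_⟩
  · rw [attachCells_d, ← hp, Category.assoc y, ← Preadditive.comp_neg]
    refine (Category.assoc _ _ _).trans (congrArg (fun t => y ≫ t) ?_)
    exact inr_attachD g j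
  · rw [zero_comp, add_zero, ← hq]
    refine (Category.assoc _ _ _).trans (congrArg (fun t => y ≫ t) ?_)
    exact biprod.inr_desc _ _

end Cells

end Attach

/-! ### The small object argument -/

lemma isSplitMono_ι_zero {C : Type*} [Category C] {X : ℕ ⥤ C} {c : Cocone X} (hc : IsColimit c)
    (hs : ∀ n : ℕ, IsSplitMono (X.map (homOfLE n.le_succ))) : IsSplitMono (c.ι.app 0) := by
  obtain ⟨y, hy⟩ := exists_seq (T := fun n => X.obj n ⟶ X.obj 0)
    (fun n y => X.map (homOfLE n.zero_le) ≫ y = 𝟙 _)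
    (fun n y y' => X.map (homOfLE n.le_succ) ≫ y' = y)
    ⟨𝟙 _, by simp⟩ (by
      intro n y hy
      have := hs n
      have h : X.map (homOfLE n.le_succ) ≫ retraction (X.map (homOfLE n.le_succ)) ≫ y = y := by
        simp
      refine ⟨_, ?_, h⟩
      rw [← homOfLE_comp n.zero_le n.le_succ, X.map_comp, Category.assoc, h, hy])
  have h₀ : y 0 = 𝟙 _ := by simpa using (hy 0).1
  exact IsSplitMono.mk' ⟨hc.desc (coconeOfSequence y fun n => (hy n).2),
    (hc.fac _ 0).trans h₀⟩

lemma isZero_of_isColimit {C : Type*} [Category C] [HasZeroMorphisms C] {X : ℕ ⥤ C} {c : Cocone X}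
    (hc : IsColimit c) (hX : ∀ n, IsZero (X.obj n)) : IsZero c.pt := by
  rw [IsZero.iff_id_eq_zero]
  exact hc.hom_ext fun n => (hX n).eq_of_src _ _

/-- A complex whose terms and itself have the lifting property and which vanishes in degrees
larger than `b`. -/
structure IsBoundedLifting (b : ℤ) (P : CochainComplex (ModuleCat.{u} R) ℤ) : Prop where
  hasLifting : ∀ i, HasLifting (P.X i)
  hasCochainLifting : HasCochainLifting P
  isZero : ∀ i, b < i → IsZero (P.X i)

section Factorization

variable {P N : CochainComplex (ModuleCat.{u} R) ℤ} (g : P ⟶ N)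

/-- The sequence of complexes over `N` obtained by repeatedly attaching cells. -/
def cellSequence : ℕ → Over N
  | 0 => Over.mk g
  | n + 1 => Over.mk (attachDesc (cellSequence n).hom)

/-- The direct system of complexes obtained by repeatedly attaching cells. -/
def cellSystem : ℕ ⥤ CochainComplex (ModuleCat.{u} R) ℤ :=
  Functor.ofSequence (X := fun n => (cellSequence g n).left) fun n => attachι (cellSequence g n).hom

lemma cellSystem_map (n : ℕ) :
    (cellSystem g).map (homOfLE n.le_succ) = attachι (cellSequence g n).hom :=
  Functor.ofSequence_map_homOfLE_succ _ _

/-- The morphisms from the complexes in `cellSystem g` to `N`. -/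
def cellCocone : Cocone (cellSystem g) :=
  coconeOfSequence (X := cellSystem g) (fun n => (cellSequence g n).hom) fun n => by
    rw [cellSystem_map]
    exact attachι_desc _

/-- Every morphism between bounded above complexes factors as a degreewise split monomorphism
followed by a pure quasi-isomorphism. -/
lemma exists_factorization {b : ℤ} (hP : IsBoundedLifting b P)
    (hN : ∀ i, b < i → IsZero (N.X i)) :
    ∃ (P' : CochainComplex (ModuleCat.{u} R) ℤ) (f : P ⟶ P') (g' : P' ⟶ N), f ≫ g' = g ∧
      (∀ i, IsSplitMono (f.f i)) ∧ IsBoundedLifting b P' ∧ IsConeExact g' := by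
  have hX : ∀ n, IsBoundedLifting b ((cellSystem g).obj n) := by
    intro n
    induction n with
    | zero => exact hP
    | succ n ih =>
      exact ⟨hasLifting_attachCells _ ih.hasLifting,
        hasCochainLifting_attachCells _ ih.hasCochainLifting, fun i hi =>
        isZero_attachCells _ (ih.isZero i hi) (ih.isZero (i + 1) (by lia)) (hN i hi)⟩
  have hs : ∀ (n : ℕ) (i : ℤ), IsSplitMono (((cellSystem g).map (homOfLE n.le_succ)).f i) := by
    intro n i
    rw [cellSystem_map]
    exact inferInstanceAs (IsSplitMono ((attachι (cellSequence g n).hom).f i))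
  let c := colimit.cocone (cellSystem g)
  have hc : IsColimit c := colimit.isColimit _
  have hci (i : ℤ) := isColimitOfPreserves (HomologicalComplex.eval _ _ i) hc
  refine ⟨c.pt, c.ι.app 0, hc.desc (cellCocone g), hc.fac _ 0,
    fun i => isSplitMono_ι_zero (hci i) fun n => hs n i,
    ⟨fun i => HasLifting.of_isColimit (hci i) (fun n => (hX n).hasLifting i) fun n => hs n i,
      HasCochainLifting.of_isColimit hc (fun n => (hX n).hasCochainLifting) hs,
      fun i hi => isZero_of_isColimit (hci i) fun n => (hX n).isZero i hi⟩, ?_⟩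
  -- The target is fixed, so it is viewed as the colimit of a constant system; a cocycle at stage
  -- `n` is bounded at stage `n + 1`.
  let c' : Cocone ((Functor.const ℕ).obj N) := { pt := N, ι := 𝟙 _ }
  have hc' : IsFPColimit c' :=
    ⟨fun F _ i x => ⟨0, x, Category.comp_id _⟩, fun F _ i n x hx => ⟨n, le_rfl, hx⟩⟩
  refine isConeExact_of_isFPColimit (cellCocone g).ι (isFPColimit_of_isColimit hc) hc' _
    (fun n => (hc.fac _ n).trans (Category.comp_id _).symm) ?_
  intro n F _ j p q h
  refine ⟨n + 1, n.le_succ, ?_⟩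
  have := isConeBoundary_attachCells (cellSequence g n).hom F j p q h
  have hq : q ≫ (((Functor.const ℕ).obj N).map (homOfLE n.le_succ)).f j = q := Category.comp_id _
  rw [cellSystem_map]
  exact (congrArg (IsConeBoundary (attachDesc (cellSequence g n).hom) _) hq).mpr this

end Factorization

/-! ### Truncations and special direct systems -/

open ComplexShape in
-- The inequality is strict because degree `n` holds only the kernel. The inclusion is dual to the
-- projection `πTruncGE` of the opposite complex, whose isomorphism range is known.
lemma isIso_ιTruncLE_f (M : CochainComplex (ModuleCat.{u} R) ℤ) {i n : ℤ} (h : i < n) :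
    IsIso ((M.ιTruncLE n).f i) := by
  have hi : (embeddingUpIntLE n).f (n - i).natAbs = i := by
    change n - ((n - i).natAbs : ℤ) = i
    lia
  have hi' : ¬ (embeddingUpIntLE n).BoundaryLE (n - i).natAbs := by
    rw [boundaryLE_embeddingUpIntLE_iff, Int.natAbs_eq_zero]
    lia
  have : IsIso ((HomologicalComplex.πTruncGE (HomologicalComplex.op M)
      (embeddingUpIntLE n).op).f i) := by
    refine (Embedding.isIso_liftExtend_f_iff (embeddingUpIntLE n).op _ _ hi).2 ?_
    exact HomologicalComplex.isIso_restrictionToTruncGE' _ _ _ (by simpa using hi')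
  exact inferInstanceAs (IsIso ((HomologicalComplex.πTruncGE (HomologicalComplex.op M)
      (embeddingUpIntLE n).op).f i).unop)

lemma exists_comp_ιTruncLE_f_eq (M : CochainComplex (ModuleCat.{u} R) ℤ) {i n : ℤ} (h : i < n)
    {F : ModuleCat.{u} R} (x : F ⟶ M.X i) :
    ∃ y : F ⟶ (M.truncLE n).X i, y ≫ (M.ιTruncLE n).f i = x := by
  have := isIso_ιTruncLE_f M h
  exact ⟨x ≫ inv ((M.ιTruncLE n).f i), by simp⟩

lemma eq_zero_of_comp_ιTruncLE_f (M : CochainComplex (ModuleCat.{u} R) ℤ) {i n : ℤ}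
    {F : ModuleCat.{u} R} (x : F ⟶ (M.truncLE n).X i) (hx : x ≫ (M.ιTruncLE n).f i = 0) :
    x = 0 := by
  have : Mono ((M.ιTruncLE n).f i) := by
    dsimp [CochainComplex.ιTruncLE]
    infer_instance
  exact zero_of_comp_mono _ hx

lemma isFPColimit_truncLECocone (M : CochainComplex (ModuleCat.{u} R) ℤ) :
    IsFPColimit (truncLECocone M) where
  exists_lift _ _ i x :=
    -- A natural number strictly above `i`, also for negative `i`.
    ⟨(i + 1).toNat, exists_comp_ιTruncLE_f_eq M (n := ((i + 1).toNat : ℤ)) (by lia) x⟩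
  exists_eq_zero _ _ _ n x hx :=
    have h : x = 0 := eq_zero_of_comp_ιTruncLE_f M x hx
    ⟨n, le_rfl, by rw [h, zero_comp]⟩

lemma isZero_truncLE (M : CochainComplex (ModuleCat.{u} R) ℤ) {n i : ℤ} (h : n < i) :
    IsZero ((M.truncLE n).X i) :=
  CochainComplex.isZero_of_isStrictlyLE _ n i h

lemma IsBoundedLifting.mono {b b' : ℤ} (h : b ≤ b') {P : CochainComplex (ModuleCat.{u} R) ℤ}
    (hP : IsBoundedLifting b P) : IsBoundedLifting b' P :=
  ⟨hP.1, hP.2, fun i hi => hP.3 i (by lia)⟩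

lemma isBoundedLifting_of_isZero (b : ℤ) {Z : CochainComplex (ModuleCat.{u} R) ℤ}
    (hZ : IsZero Z) : IsBoundedLifting b Z := by
  have h : ∀ i, IsZero (Z.X i) := fun i => (HomologicalComplex.eval _ _ i).map_isZero hZ
  have h' : ∀ i, HasLifting (Z.X i) := fun i _ _ _ _ _ _ _ _ _ => ⟨0, (h i).eq_of_src _ _⟩
  exact ⟨h', HasCochainLifting.of_d_eq_zero (fun i _ => (h i).eq_of_src _ _) h', fun i _ => h i⟩

/-- Degreewise retractions split the cokernel sequences, and the lifting property passes to the
quotient of a degreewise split sequence. -/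
lemma isSpecialDirectSystem_of_isSplitMono {P : ℕ ⥤ CochainComplex (ModuleCat.{u} R) ℤ}
    (hP : ∀ n, HasCochainLifting (P.obj n))
    (hs : ∀ (n : ℕ) (i : ℤ), IsSplitMono ((P.map (homOfLE n.le_succ)).f i)) :
    IsSpecialDirectSystem IsKPureProjective P := by
  have h : ∀ (n : ℕ) (i : ℤ), Nonempty
      ((cokernelSequence (P.map (homOfLE n.le_succ))).map
        (HomologicalComplex.eval (ModuleCat.{u} R) (ComplexShape.up ℤ) i)).Splitting := by
    intro n i
    let S := cokernelSequence (P.map (homOfLE n.le_succ))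
    have hS : S.Exact := ShortComplex.exact_cokernel _
    have : Epi S.g := coequalizer.π_epi
    obtain ⟨⟨r⟩⟩ := hs n i
    exact ⟨ShortComplex.Splitting.ofExactOfRetraction _ (hS.map (HomologicalComplex.eval _ _ i))
      r.retraction r.id (inferInstanceAs (Epi ((HomologicalComplex.eval _ _ i).map S.g)))⟩
  refine ⟨(hP 0).isKPureProjective, fun n => HomologicalComplex.mono_of_mono_f _ fun i => ?_,
    fun n => ?_, h⟩
  · have := hs n i
    infer_instance
  · let σ (i : ℤ) := (h n i).some
    exact (HasCochainLifting.quotient (P.map (homOfLE n.le_succ)) (cokernel.π _)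
      (fun i => (σ i).r) (fun i => (σ i).s) (cokernel.condition _) (fun i => (σ i).f_r)
      (fun i => (σ i).s_g) (fun i => (σ i).id) (hP n) (hP (n + 1))).isKPureProjective

end PureResolution

end

/-! ### Construction of the resolution -/

open PureResolution

theorem mainTheorem2 (R : Type u) [CommRing R] (M : CochainComplex (ModuleCat.{u} R) ℤ) :
    ∃ (P : ℕ ⥤ CochainComplex (ModuleCat.{u} R) ℤ)
      (φ : P ⟶ PureResolution.truncLESystem M)
      (c : Cocone P) (hc : IsColimit c),
      PureResolution.IsSpecialDirectSystem PureResolution.IsKPureProjective P ∧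
      (∀ n : ℕ, PureResolution.IsBoundedAbove (P.obj n) ∧
        PureResolution.IsPureProjectiveResolution (φ.app n)) ∧
      PureResolution.IsPureProjectiveResolution
        (hc.desc ((Cocone.precompose φ).obj (PureResolution.truncLECocone M))) := by
  obtain ⟨X, hX⟩ := exists_seq (T := fun n : ℕ => Over ((truncLESystem M).obj n))
    (fun n X => IsBoundedLifting n X.left ∧ IsConeExact X.hom)
    (fun n X X' => ∃ f : X.left ⟶ X'.left,
      f ≫ X'.hom = X.hom ≫ (truncLESystem M).map (homOfLE n.le_succ) ∧
        ∀ i, IsSplitMono (f.f i)) (by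
      -- `P₀` arises by factoring `0 ⟶ τ_{≤ 0} M`.
      obtain ⟨Z, hZ⟩ := HasZeroObject.zero (C := CochainComplex (ModuleCat.{u} R) ℤ)
      obtain ⟨P, f, g, -, -, hP, hg⟩ := exists_factorization (b := (0 : ℕ))
        (0 : Z ⟶ (truncLESystem M).obj 0) (isBoundedLifting_of_isZero _ hZ) fun i hi => isZero_truncLE M hi
      exact ⟨Over.mk g, hP, hg⟩) (by
      rintro n X ⟨hX, -⟩
      obtain ⟨P, f, g, hfg, hf, hP, hg⟩ := exists_factorization
        (X.hom ≫ (truncLESystem M).map (homOfLE n.le_succ))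
        (hX.mono (b' := (n + 1 : ℕ)) (by lia)) fun i hi => isZero_truncLE M hi
      exact ⟨Over.mk g, ⟨hP, hg⟩, f, hfg, hf⟩)
  choose hX f hf hs using hX
  let P : ℕ ⥤ CochainComplex (ModuleCat.{u} R) ℤ := Functor.ofSequence f
  have hPf : ∀ n : ℕ, P.map (homOfLE n.le_succ) = f n := Functor.ofSequence_map_homOfLE_succ f
  let φ : P ⟶ truncLESystem M := NatTrans.ofSequence (fun n => (X n).hom) fun n =>
    (congrArg (fun t => t ≫ (X (n + 1)).hom) (hPf n)).trans (hf n)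
  have hPs : ∀ (n : ℕ) (i : ℤ), IsSplitMono ((P.map (homOfLE n.le_succ)).f i) := by
    intro n i
    rw [hPf]
    exact hs n i
  let c := colimit.cocone P
  have hc : IsColimit c := colimit.isColimit _
  have hci (i : ℤ) := isColimitOfPreserves (HomologicalComplex.eval _ _ i) hc
  have hP : ∀ n, HasCochainLifting (P.obj n) := fun n => (hX n).1.hasCochainLifting
  refine ⟨P, φ, c, hc, isSpecialDirectSystem_of_isSplitMono hP hPs,
    fun n => ⟨⟨n, (hX n).1.isZero⟩, fun i => ((hX n).1.hasLifting i).isPureProjective,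
      (hX n).2.isPureQuasiIso, (hP n).isKPureProjective⟩,
    fun i => (HasLifting.of_isColimit (hci i) (fun n => (hX n).1.hasLifting i)
      fun n => hPs n i).isPureProjective, ?_,
    (HasCochainLifting.of_isColimit hc hP hPs).isKPureProjective⟩
  refine (isConeExact_of_isFPColimit φ (isFPColimit_of_isColimit hc)
    (isFPColimit_truncLECocone M) _ (fun n => hc.fac _ n) ?_).isPureQuasiIso
  intro n F _ j p q h
  -- Every `φ.app n` already has an exact cone, so no later stage is needed.
  refine ⟨n, le_rfl, ?_⟩
  simp only [homOfLE_refl, CategoryTheory.Functor.map_id, HomologicalComplex.id_f,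
    Category.comp_id]
  exact (hX n).2 F j p q h
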